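/- Let $S_\infty$ be the group of permutations of $\{1,2,3,\dots\}$ fixing all but finitely many elements, and let $s_k$ be the simple transposition swapping $k$ and $k+1$. A positive integer $i$ is a left descent of $w\in S_\infty$ if $w^{-1}(i)>w^{-1}(i+1)$, and $<$ denotes the (strict) Bruhat order on $S_\infty$. Let $\mathfrak{S}_w\in\mathbb{Z}[x_1,x_2,\dots]$ ($w\in S_\infty$) be the Schubert polynomials, determined by $\mathfrak{S}_{n\cdots 21}=x_1^{n-1}x_2^{n-2}\cdots x_n^0$ and $\mathfrak{S}_{ws_i}=(\mathfrak{S}_w-s_i\cdot\mathfrak{S}_w)/(x_i-x_{i+1})$ whenever $w(i)>w(i+1)$, where $s_i$ acts on polynomials by swapping $x_i$ and $x_{i+1}$. For $u,v\in S_\infty$ let the Schubert structure coefficients $c_{u,v}^w\in\mathbb{Z}$ be the unique integers, all but finitely many of them zero, with $$\mathfrak{S}_u\,\mathfrak{S}_v=\sum_{w\in S_\infty}c_{u,v}^w\,\mathfrak{S}_w .$$ Corollary. Let $u,v\in S_\infty$ and let $\alpha$ be a positive integer such that every left descent of $u$ and every left descent of $v$ is a multiple of $\alpha$. Then the coefficients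 $c_{u,v}^w$ exist and are unique, and for every $w\in S_\infty$ the following sum over the positive integers $k$ with $s_kw>w$ has only finitely many nonzero terms and satisfies $$\sum_{k\,:\,s_kw>w}k\,c_{u,v}^{s_kw}\equiv 0\pmod{\alpha}.$$ If moreover $u=v$, then for every $w\in S_\infty$ $$\sum_{k\,:\,s_kw>w}k\,c_{u,u}^{s_kw}\equiv 0\pmod{2\alpha}.$$ -/

import Mathlib

noncomputable section

namespace Schubert

open MvPolynomial

/-- The infinite symmetric group: permutations of the positive integers fixing every
sufficiently large integer. -/
def SInfty : Subgroup (Equiv.Perm ℕ+) where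
  carrier := {w | ∃ n : ℕ, ∀ i : ℕ+, n < (i : ℕ) → w i = i}
  one_mem' := ⟨0, fun _ _ => rfl⟩
  mul_mem' := by
    rintro a b ⟨m, hm⟩ ⟨n, hn⟩
    refine ⟨max m n, fun i hi => ?_⟩
    rw [Equiv.Perm.mul_apply, hn i (lt_of_le_of_lt (le_max_right _ _) hi),
      hm i (lt_of_le_of_lt (le_max_left _ _) hi)]
  inv_mem' := by
    rintro a ⟨m, hm⟩
    refine ⟨m, fun i hi => ?_⟩
    rw [Equiv.Perm.inv_eq_iff_eq, hm i hi]

theorem exists_bound (w : SInfty) :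
    ∃ n : ℕ, ∀ i : ℕ+, n < (i : ℕ) → (w : Equiv.Perm ℕ+) i = i :=
  w.2

/-- The transposition `t_{i,j}` of `i` and `j`. -/
def transposition (i j : ℕ+) : SInfty :=
  ⟨Equiv.swap i j, max (i : ℕ) (j : ℕ), fun k hk => by
    apply Equiv.swap_apply_of_ne_of_ne <;> rintro rfl <;> simp at hk⟩

/-- The simple transposition `s_i`, swapping `i` and `i + 1`. -/
def s (i : ℕ+) : SInfty := transposition i (i + 1)

/-- The Coxeter length: the least length of a word `(a₁, …, a_l)` with
`w = s_{a₁} ⋯ s_{a_l}`. -/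
def length (w : SInfty) : ℕ :=
  sInf {l : ℕ | ∃ a : List ℕ+, a.length = l ∧ (a.map s).prod = w}

/-- The covering relation `a ⋖ b` of Bruhat order: `a = b t_{i,j}` and `ℓ(a) = ℓ(b) - 1`. -/
def BruhatCovers (a b : SInfty) : Prop :=
  (∃ i j : ℕ+, i ≠ j ∧ a = b * transposition i j) ∧ length a + 1 = length b

/-- The strict Bruhat order `a < b`: the transitive closure of the covering relation. -/
def BruhatLT : SInfty → SInfty → Prop := Relation.TransGen BruhatCovers

/-- `i` is a left descent of `w` if `w⁻¹(i) > w⁻¹(i+1)`. -/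
def IsLeftDescent (w : SInfty) (i : ℕ+) : Prop :=
  (w : Equiv.Perm ℕ+)⁻¹ (i + 1) < (w : Equiv.Perm ℕ+)⁻¹ i

/-- The action of `s_i` on polynomials in `x₁, x₂, …`, swapping `x_i` and `x_{i+1}`. -/
def swapVars (i : ℕ+) : MvPolynomial ℕ+ ℤ →ₐ[ℤ] MvPolynomial ℕ+ ℤ :=
  rename (Equiv.swap i (i + 1))

theorem sub_dvd_sub_swapVars (i : ℕ+) (f : MvPolynomial ℕ+ ℤ) :
    (X i - X (i + 1) : MvPolynomial ℕ+ ℤ) ∣ f - swapVars i f := by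
  induction f using MvPolynomial.induction_on with
  | C a => simp [swapVars]
  | add p q hp hq =>
    rw [map_add, add_sub_add_comm]
    exact dvd_add hp hq
  | mul_X p j hp =>
    have hj : (X i - X (i + 1) : MvPolynomial ℕ+ ℤ) ∣ X j - swapVars i (X j) := by
      rw [swapVars, rename_X]
      rcases eq_or_ne j i with rfl | h1
      · rw [Equiv.swap_apply_left]
      · rcases eq_or_ne j (i + 1) with rfl | h2
        · rw [Equiv.swap_apply_right, ← neg_sub]
          exact (neg_dvd (α := MvPolynomial ℕ+ ℤ)).2 dvd_rfl
        · rw [Equiv.swap_apply_of_ne_of_ne h1 h2, sub_self]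
          exact dvd_zero _
    have key : p * X j - swapVars i (p * X j)
        = (p - swapVars i p) * X j + swapVars i p * (X j - swapVars i (X j)) := by
      rw [map_mul]; ring
    rw [key]
    exact dvd_add (hp.mul_right _) (hj.mul_left _)

/-- The Newton divided difference `N_i f = (f - s_i f) / (x_i - x_{i+1})`: the (unique)
quotient of this exact division. -/
def dividedDifference (i : ℕ+) (f : MvPolynomial ℕ+ ℤ) : MvPolynomial ℕ+ ℤ :=
  (sub_dvd_sub_swapVars i f).choose

theorem dividedDifference_spec (i : ℕ+) (f : MvPolynomial ℕ+ ℤ) :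
    (X i - X (i + 1)) * dividedDifference i f = f - swapVars i f :=
  (sub_dvd_sub_swapVars i f).choose_spec.symm

/-- The monomial `x₁^{n-1} x₂^{n-2} ⋯ x_n^0`. -/
def staircase (n : ℕ) : MvPolynomial ℕ+ ℤ :=
  ∏ i ∈ Finset.range n, X i.succPNat ^ (n - 1 - i)

theorem weight_mul_swap_lt (n : ℕ) (w : Equiv.Perm ℕ+) (i : ℕ+) (hi : (i : ℕ) < n)
    (h : w i < w (i + 1)) :
    ∑ a ∈ Finset.range n, (a + 1) * ((w * Equiv.swap i (i + 1)) a.succPNat : ℕ)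
      < ∑ a ∈ Finset.range n, (a + 1) * (w a.succPNat : ℕ) := by
  obtain ⟨m, rfl⟩ : ∃ m : ℕ, i = m.succPNat := ⟨i.natPred, (PNat.succPNat_natPred i).symm⟩
  have e : m.succPNat + 1 = (m + 1).succPNat := by
    apply PNat.eq; simp
  rw [e] at h ⊢
  have hm : m + 1 < n := by simpa using hi
  have h1 : m ∈ Finset.range n := by simp; omega
  have h2 : m + 1 ∈ (Finset.range n).erase m := by simp; omega
  rw [← Finset.add_sum_erase _ _ h1, ← Finset.add_sum_erase _ _ h2,
    ← Finset.add_sum_erase (Finset.range n) (fun a => (a + 1) * (w a.succPNat : ℕ)) h1,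
    ← Finset.add_sum_erase _ (fun a => (a + 1) * (w a.succPNat : ℕ)) h2]
  have h3 : ∑ a ∈ ((Finset.range n).erase m).erase (m + 1),
      (a + 1) * ((w * Equiv.swap m.succPNat (m + 1).succPNat) a.succPNat : ℕ)
      = ∑ a ∈ ((Finset.range n).erase m).erase (m + 1), (a + 1) * (w a.succPNat : ℕ) := by
    refine Finset.sum_congr rfl fun a ha => ?_
    simp only [Finset.mem_erase] at ha
    rw [Equiv.Perm.mul_apply, Equiv.swap_apply_of_ne_of_ne]
    · exact fun h => ha.2.1 (Nat.succPNat_injective h)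
    · exact fun h => ha.1 (Nat.succPNat_injective h)
  rw [h3, Equiv.Perm.mul_apply, Equiv.Perm.mul_apply, Equiv.swap_apply_left,
    Equiv.swap_apply_right]
  have h4 : (w m.succPNat : ℕ) < (w (m + 1).succPNat : ℕ) := by exact_mod_cast h
  nlinarith

open Classical in
/-- The Schubert polynomial of `w`, where `w` is regarded as an element of `S_n`. If `w` has
no ascent at a position `i < n`, then `w = n ⋯ 2 1` is the long element and its polynomial is
`x₁^{n-1} ⋯ x_n^0`. Otherwise, for a position `i < n` with `w(i) < w(i+1)`, so that
`w = (w s_i) s_i` with `i` a descent of `w s_i`, the polynomial of `w` is `N_i` of the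
polynomial of `w s_i`. (The result does not depend on the ascent that is selected.) -/
def schubertIn (n : ℕ) (w : Equiv.Perm ℕ+) : MvPolynomial ℕ+ ℤ :=
  if h : ∃ i : ℕ+, (i : ℕ) < n ∧ w i < w (i + 1) then
    dividedDifference h.choose (schubertIn n (w * Equiv.swap h.choose (h.choose + 1)))
  else
    staircase n
termination_by ∑ a ∈ Finset.range n, (a + 1) * (w a.succPNat : ℕ)
decreasing_by exact weight_mul_swap_lt n w _ h.choose_spec.1 h.choose_spec.2

open Classical in
/-- The Schubert polynomial `𝔖_w` of `w ∈ S_∞`, computed in the smallest `S_n` containing `w`. -/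
def schubert (w : SInfty) : MvPolynomial ℕ+ ℤ :=
  schubertIn (Nat.find (exists_bound w)) (w : Equiv.Perm ℕ+)

/-- `c` is the family of coefficients of an expansion of `f` as a (finite) integer linear
combination of Schubert polynomials, `f = ∑ w, c_w 𝔖_w`. -/
def IsSchubertExpansion (f : MvPolynomial ℕ+ ℤ) (c : SInfty →₀ ℤ) : Prop :=
  f = c.sum fun w a => a • schubert w

open Classical in
/-- The Schubert structure coefficients: `structureCoeff u v w` is `c_{u,v}^w`, where
`𝔖_u 𝔖_v = ∑ w, c_{u,v}^w 𝔖_w`. -/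
def structureCoeff (u v : SInfty) : SInfty →₀ ℤ :=
  if h : ∃ c : SInfty →₀ ℤ, IsSchubertExpansion (schubert u * schubert v) c then h.choose else 0

end Schubert

end

noncomputable section

namespace Schubert

open MvPolynomial

/-! Let `∇ = ∑ ∂/∂x_i`. It kills `x_i - x_{i+1}` and commutes with swapping variables, hence
commutes with every divided difference (`nabla_ddLin`). Differentiating the staircase monomial and
descending by divided differences gives `∇ 𝔖_w = ∑ k 𝔖_{s_k w}` over the left descents `k` of `w`
(`nabla_schubert`). Consequently the sum in the theorem is exactly the coefficient of `𝔖_w` in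
`∇(𝔖_u 𝔖_v)` (`coeffFun_nabla`). By the hypothesis on descents, `∇ 𝔖_u` and `∇ 𝔖_v` are divisible by
`α`, so the Leibniz rule makes `∇(𝔖_u 𝔖_v)` divisible by `α`. For `u = v` it equals `2 𝔖_u ∇ 𝔖_u`,
which supplies the extra factor 2.

The remaining work is the basic theory: Schubert polynomials depend neither on the chosen ascents
(`schubertIn_eq`) nor on the ambient `S_n` (`schubertIn_succ`), and they form a ℤ-basis. For the
basis property, the functionals `f ↦ (∂_w f)(0)` are dual to the `𝔖_w` (`coeffFun_schubert`), and
spanning follows by induction on degree, since a polynomial killed by all divided differences is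
constant (`mem_schubertSpan_all`). -/

/-! ### Divided differences and their braid relations -/

theorem X_sub_X_ne_zero {i j : ℕ+} (h : i ≠ j) : (X i - X j : MvPolynomial ℕ+ ℤ) ≠ 0 :=
  sub_ne_zero.2 fun e => h (X_injective e)

theorem X_sub_X_succ_ne_zero (i : ℕ+) : (X i - X (i + 1) : MvPolynomial ℕ+ ℤ) ≠ 0 :=
  X_sub_X_ne_zero (PNat.lt_add_right i 1).ne

/-- The polynomial ring is a domain, so the quotient is unique; identities between divided
differences can therefore be checked after clearing denominators. -/
theorem dividedDifference_eq {i : ℕ+} {f g : MvPolynomial ℕ+ ℤ}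
    (h : (X i - X (i + 1)) * g = f - swapVars i f) : dividedDifference i f = g :=
  mul_left_cancel₀ (X_sub_X_succ_ne_zero i) ((dividedDifference_spec i f).trans h.symm)

/-- The divided difference as a linear map. -/
def ddLin (i : ℕ+) : MvPolynomial ℕ+ ℤ →ₗ[ℤ] MvPolynomial ℕ+ ℤ where
  toFun := dividedDifference i
  map_add' f g := dividedDifference_eq <| by
    rw [mul_add, dividedDifference_spec, dividedDifference_spec, map_add]; ring
  map_smul' a f := dividedDifference_eq <| by
    rw [RingHom.id_apply, mul_smul_comm, dividedDifference_spec, map_smul, smul_sub]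

theorem ddLin_spec (i : ℕ+) (f : MvPolynomial ℕ+ ℤ) :
    (X i - X (i + 1)) * ddLin i f = f - swapVars i f := dividedDifference_spec i f

theorem ddLin_eq {i : ℕ+} {f g : MvPolynomial ℕ+ ℤ}
    (h : (X i - X (i + 1)) * g = f - swapVars i f) : ddLin i f = g := dividedDifference_eq h

theorem swapVars_X_self (i : ℕ+) : swapVars i (X i) = X (i + 1) := by
  rw [swapVars, rename_X, Equiv.swap_apply_left]

theorem swapVars_X_succ (i : ℕ+) : swapVars i (X (i + 1)) = X i := by
  rw [swapVars, rename_X, Equiv.swap_apply_right]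

theorem swapVars_X_of_ne {i j : ℕ+} (h1 : j ≠ i) (h2 : j ≠ i + 1) : swapVars i (X j) = X j := by
  rw [swapVars, rename_X, Equiv.swap_apply_of_ne_of_ne h1 h2]

theorem swapVars_swapVars (i : ℕ+) (f : MvPolynomial ℕ+ ℤ) : swapVars i (swapVars i f) = f := by
  rw [swapVars, rename_rename]
  have : (Equiv.swap i (i + 1) ∘ Equiv.swap i (i + 1) : ℕ+ → ℕ+) = id := by
    ext x; simp
  rw [this, rename_id_apply]

theorem swap_comm_of_lt {i j : ℕ+} (h : i + 1 < j) :
    Equiv.swap i (i + 1) * Equiv.swap j (j + 1) = Equiv.swap j (j + 1) * Equiv.swap i (i + 1) := by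
  have h' : ((i : ℕ) + 1 < j) := by exact_mod_cast h
  have : Equiv.Perm.Disjoint (Equiv.swap i (i + 1)) (Equiv.swap j (j + 1)) := by
    refine Equiv.Perm.disjoint_swap_swap ?_
    simp only [List.nodup_cons, List.mem_cons, List.not_mem_nil, not_or, ← PNat.coe_inj,
      PNat.add_coe, PNat.one_coe]
    simp only [add_left_inj, List.nodup_nil, and_true, not_false_eq_true]
    omega
  exact this.commute.eq

theorem swapVars_comm {i j : ℕ+} (h : i + 1 < j) (f : MvPolynomial ℕ+ ℤ) :
    swapVars i (swapVars j f) = swapVars j (swapVars i f) := by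
  simp only [swapVars, rename_rename]
  congr 2
  exact congrArg (fun e : Equiv.Perm ℕ+ => (e : ℕ+ → ℕ+)) (swap_comm_of_lt h)

theorem swap_braid (i : ℕ+) :
    Equiv.swap i (i + 1) * Equiv.swap (i + 1) (i + 1 + 1) * Equiv.swap i (i + 1)
      = Equiv.swap (i + 1) (i + 1 + 1) * Equiv.swap i (i + 1)
        * Equiv.swap (i + 1) (i + 1 + 1) := by
  have h1 : i ≠ i + 1 := (PNat.lt_add_right i 1).ne
  have h2 : i + 1 ≠ i + 1 + 1 := (PNat.lt_add_right (i + 1) 1).ne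
  have h3 : i ≠ i + 1 + 1 := ((PNat.lt_add_right i 1).trans (PNat.lt_add_right (i + 1) 1)).ne
  have e1 := Equiv.swap_mul_swap_mul_swap (x := i) (y := i + 1) (z := i + 1 + 1) h1 h3
  have e2 := Equiv.swap_mul_swap_mul_swap (x := i + 1 + 1) (y := i + 1) (z := i) h2.symm h3.symm
  rw [Equiv.swap_comm (i + 1) i, Equiv.swap_comm (i + 1 + 1) (i + 1)] at e2
  rw [e1, e2, Equiv.swap_comm]

theorem swapVars_braid (i : ℕ+) (f : MvPolynomial ℕ+ ℤ) :
    swapVars i (swapVars (i + 1) (swapVars i f))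
      = swapVars (i + 1) (swapVars i (swapVars (i + 1) f)) := by
  simp only [swapVars, rename_rename]
  congr 2
  exact congrArg (fun e : Equiv.Perm ℕ+ => (e : ℕ+ → ℕ+)) (swap_braid i)

theorem swapVars_ddLin (i : ℕ+) (f : MvPolynomial ℕ+ ℤ) :
    swapVars i (ddLin i f) = ddLin i f := by
  refine (ddLin_eq ?_).symm
  have h := congrArg (swapVars i) (ddLin_spec i f)
  rw [map_mul, map_sub, map_sub, swapVars_X_self, swapVars_X_succ, swapVars_swapVars] at h
  linear_combination -h

theorem ddLin_ddLin (i : ℕ+) (f : MvPolynomial ℕ+ ℤ) : ddLin i (ddLin i f) = 0 :=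
  ddLin_eq (by rw [swapVars_ddLin]; simp)

/-- After clearing denominators both sides become `f - s_i f - s_j f + s_i s_j f`. -/
theorem ddLin_comm {i j : ℕ+} (h : i + 1 < j) (f : MvPolynomial ℕ+ ℤ) :
    ddLin i (ddLin j f) = ddLin j (ddLin i f) := by
  have hi : i < i + 1 := PNat.lt_add_right i 1
  have hj : j < j + 1 := PNat.lt_add_right j 1
  have key := congrArg (swapVars i) (ddLin_spec j f)
  have key' := congrArg (swapVars j) (ddLin_spec i f)
  rw [map_mul, map_sub, map_sub, swapVars_X_of_ne (hi.trans h).ne' h.ne',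
    swapVars_X_of_ne (hi.trans (h.trans hj)).ne' (h.trans hj).ne'] at key
  rw [map_mul, map_sub, map_sub, swapVars_X_of_ne (hi.trans h).ne (hi.trans (h.trans hj)).ne,
    swapVars_X_of_ne h.ne (h.trans hj).ne, ← swapVars_comm h] at key'
  refine mul_left_cancel₀ (X_sub_X_succ_ne_zero i)
    (mul_left_cancel₀ (X_sub_X_succ_ne_zero j) ?_)
  linear_combination (X j - X (j + 1)) * ddLin_spec i (ddLin j f)
    - (X i - X (i + 1)) * ddLin_spec j (ddLin i f) + ddLin_spec j f - key
    - ddLin_spec i f + key'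

/-- Multiplied by the Vandermonde product of `x_i, x_{i+1}, x_{i+2}`, both sides become the
alternating sum of `f` over the copy of `S_3` permuting these variables. -/
theorem ddLin_braid (i : ℕ+) (f : MvPolynomial ℕ+ ℤ) :
    ddLin i (ddLin (i + 1) (ddLin i f)) = ddLin (i + 1) (ddLin i (ddLin (i + 1) f)) := by
  have h1 : i ≠ i + 1 := (PNat.lt_add_right i 1).ne
  have h2 : i + 1 ≠ i + 1 + 1 := (PNat.lt_add_right (i + 1) 1).ne
  have h3 : i ≠ i + 1 + 1 := ((PNat.lt_add_right i 1).trans (PNat.lt_add_right (i + 1) 1)).ne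
  have sc : swapVars i (X (i + 1 + 1)) = X (i + 1 + 1) := swapVars_X_of_ne h3.symm h2.symm
  have ta : swapVars (i + 1) (X i) = X i := swapVars_X_of_ne h1 h3
  have sa := swapVars_X_self i
  have sb := swapVars_X_succ i
  have tb := swapVars_X_self (i + 1)
  have tc := swapVars_X_succ (i + 1)
  have e1 := ddLin_spec i f
  have e1t := congrArg (swapVars (i + 1)) e1
  have e2 := ddLin_spec (i + 1) (ddLin i f)
  have e2s := congrArg (swapVars i) e2
  have e1ts := congrArg (swapVars i) e1t
  have e1s := congrArg (swapVars i) e1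
  have e3 := ddLin_spec i (ddLin (i + 1) (ddLin i f))
  have d1 := ddLin_spec (i + 1) f
  have d1t := congrArg (swapVars i) d1
  have d2 := ddLin_spec i (ddLin (i + 1) f)
  have d2s := congrArg (swapVars (i + 1)) d2
  have d1ts := congrArg (swapVars (i + 1)) d1t
  have d3 := ddLin_spec (i + 1) (ddLin i (ddLin (i + 1) f))
  have hbr := swapVars_braid i f
  simp only [map_mul, map_sub, sa, sb, sc, ta, tb, tc, swapVars_ddLin] at e1 e1t e2 e2s e1ts e3 d1 d1t d2 d2s d1ts d3
  refine mul_left_cancel₀ (X_sub_X_succ_ne_zero i)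
    (mul_left_cancel₀ (X_sub_X_succ_ne_zero (i + 1)) (mul_left_cancel₀ (X_sub_X_ne_zero h3) ?_))
  linear_combination (X (i + 1) - X (i + 1 + 1)) * (X i - X (i + 1 + 1)) * e3
    + (X i - X (i + 1 + 1)) * e2 - (X (i + 1) - X (i + 1 + 1)) * e2s + e1 - e1t + e1ts
    - ((X i - X (i + 1)) * (X i - X (i + 1 + 1)) * d3
    + (X i - X (i + 1 + 1)) * d2 - (X i - X (i + 1)) * d2s + d1 - d1t + d1ts) - hbr

/-! ### The derivation `∇` and its commutation with divided differences -/

/-- The derivation `∑ ∂/∂x_i`. -/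
def nabla : Derivation ℤ (MvPolynomial ℕ+ ℤ) (MvPolynomial ℕ+ ℤ) :=
  mkDerivation ℤ fun _ => 1

theorem nabla_X (i : ℕ+) : nabla (X i) = 1 := mkDerivation_X _ _ _

theorem nabla_swapVars (i : ℕ+) (f : MvPolynomial ℕ+ ℤ) :
    nabla (swapVars i f) = swapVars i (nabla f) := by
  induction f using MvPolynomial.induction_on with
  | C a => simp [swapVars, nabla]
  | add p q hp hq => simp only [map_add, hp, hq]
  | mul_X p j hp =>
    have : nabla (swapVars i (X j)) = 1 := by rw [swapVars, rename_X, nabla_X]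
    rw [map_mul, Derivation.leibniz, Derivation.leibniz, this, hp, nabla_X]
    simp

/-- Apply `∇` to the defining equation: the factor `x_i - x_{i+1}` has derivative `1 - 1 = 0`. -/
theorem nabla_ddLin (i : ℕ+) (f : MvPolynomial ℕ+ ℤ) :
    nabla (ddLin i f) = ddLin i (nabla f) := by
  refine (ddLin_eq ?_).symm
  have h := congrArg nabla (ddLin_spec i f)
  rw [Derivation.leibniz, map_sub, map_sub, nabla_X, nabla_X, nabla_swapVars] at h
  simpa using h

/-! ### Divided differences and `∇` on monomials -/

/-- The monomial `x₁^{e₀} ⋯ x_n^{e_{n-1}}`. -/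
def mono (n : ℕ) (e : ℕ → ℕ) : MvPolynomial ℕ+ ℤ := ∏ i ∈ Finset.range n, X i.succPNat ^ e i

theorem succPNat_add_one (i : ℕ) : i.succPNat + 1 = (i + 1).succPNat := by
  apply PNat.eq; simp

theorem mono_split {n i : ℕ} (h : i + 1 < n) (e : ℕ → ℕ) :
    mono n e = (∏ j ∈ ((Finset.range n).erase i).erase (i + 1), X j.succPNat ^ e j)
      * (X i.succPNat ^ e i * X (i + 1).succPNat ^ e (i + 1)) := by
  have h1 : i ∈ Finset.range n := by simp; omega
  have h2 : i + 1 ∈ (Finset.range n).erase i := by simp; omega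
  rw [mono, ← Finset.mul_prod_erase _ _ h1, ← Finset.mul_prod_erase _ _ h2]
  ring

theorem ddLin_mono {n i : ℕ} (h : i + 1 < n) (e : ℕ → ℕ) (he : e i = e (i + 1) + 1) :
    ddLin i.succPNat (mono n e) = mono n (Function.update e i (e (i + 1))) := by
  have hp : ∏ j ∈ ((Finset.range n).erase i).erase (i + 1),
      (X j.succPNat : MvPolynomial ℕ+ ℤ) ^ Function.update e i (e (i + 1)) j
      = ∏ j ∈ ((Finset.range n).erase i).erase (i + 1), X j.succPNat ^ e j := by
    refine Finset.prod_congr rfl fun j hj => ?_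
    rw [Function.update_of_ne]
    simp only [Finset.mem_erase] at hj; exact hj.2.1
  have hs : swapVars i.succPNat (∏ j ∈ ((Finset.range n).erase i).erase (i + 1),
      X j.succPNat ^ e j) = ∏ j ∈ ((Finset.range n).erase i).erase (i + 1), X j.succPNat ^ e j := by
    rw [map_prod]
    refine Finset.prod_congr rfl fun j hj => ?_
    simp only [Finset.mem_erase] at hj
    rw [map_pow, swapVars_X_of_ne]
    · exact fun h => hj.2.1 (Nat.succPNat_injective h)
    · rw [succPNat_add_one]; exact fun h => hj.1 (Nat.succPNat_injective h)
  refine ddLin_eq ?_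
  rw [mono_split h, mono_split h, hp, map_mul, hs, map_mul, map_pow, map_pow, swapVars_X_self]
  have := swapVars_X_succ i.succPNat
  rw [succPNat_add_one] at this ⊢
  rw [this, Function.update_self, Function.update_of_ne (by omega), he]
  ring

theorem staircase_eq_mono (n : ℕ) : staircase n = mono n fun i => n - 1 - i := rfl

/-- The truncated exponent `e i - 1` at `e i = 0` is harmless, because its coefficient is 0. -/
theorem nabla_mono (n : ℕ) (e : ℕ → ℕ) :
    nabla (mono n e) = ∑ i ∈ Finset.range n, (e i : ℤ) • mono n (Function.update e i (e i - 1)) := by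
  induction n with
  | zero => simp [mono]
  | succ n ih =>
    have hm : ∀ e : ℕ → ℕ, mono (n + 1) e = mono n e * X n.succPNat ^ e n := fun e =>
      Finset.prod_range_succ _ _
    have hn : mono n (Function.update e n (e n - 1)) = mono n e :=
      Finset.prod_congr rfl fun j hj => by
        rw [Function.update_of_ne (Finset.mem_range.1 hj).ne]
    rw [hm, Derivation.leibniz, Derivation.leibniz_pow, nabla_X, ih, Finset.sum_range_succ, hm, hn,
      Function.update_self, add_comm]
    congr 1
    · rw [Finset.smul_sum]
      refine Finset.sum_congr rfl fun j hj => ?_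
      rw [hm, Function.update_of_ne (Finset.mem_range.1 hj).ne', smul_eq_mul, mul_smul_comm,
        mul_comm]
    · simp
      ring

/-! ### Independence of the chosen ascent -/

/-- Confluence: a function on a group that satisfies `F w = T_i (F (w σ_i))` for one admissible
`i` at each `w` satisfies it for all of them, when both `σ` and `T` satisfy the braid relations. -/
theorem eq_of_exists_eq {G M : Type*} [Group G] (σ : ℕ+ → G) (T : ℕ+ → M → M)
    (hσc : ∀ i j, i + 1 < j → σ i * σ j = σ j * σ i)
    (hσb : ∀ i, σ i * σ (i + 1) * σ i = σ (i + 1) * σ i * σ (i + 1))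
    (hTc : ∀ i j m, i + 1 < j → T i (T j m) = T j (T i m))
    (hTb : ∀ i m, T i (T (i + 1) (T i m)) = T (i + 1) (T i (T (i + 1) m)))
    (R : ℕ+ → G → Prop) (μ : G → ℕ) (hμ : ∀ i w, R i w → μ (w * σ i) < μ w)
    (hRc : ∀ i j w, i + 1 < j → R i w → R j w → R j (w * σ i) ∧ R i (w * σ j))
    (hRb : ∀ i w, R i w → R (i + 1) w →
      R (i + 1) (w * σ i) ∧ R i (w * σ i * σ (i + 1)) ∧
      R i (w * σ (i + 1)) ∧ R (i + 1) (w * σ (i + 1) * σ i))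
    (F : G → M) (hF : ∀ w, (∃ i, R i w) → ∃ i, R i w ∧ F w = T i (F (w * σ i)))
    (w : G) (i : ℕ+) (hi : R i w) : F w = T i (F (w * σ i)) := by
  induction hm : μ w using Nat.strong_induction_on generalizing w i with
  | _ m ih =>
  have IH : ∀ w' i', μ w' < μ w → R i' w' → F w' = T i' (F (w' * σ i')) :=
    fun w' i' h hi' => ih _ (hm ▸ h) w' i' hi' rfl
  -- Commuting generators close a square two steps below `w`.
  have far : ∀ i j, i + 1 < j → R i w → R j w → T i (F (w * σ i)) = T j (F (w * σ j)) := by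
    intro i j hij hi hj
    obtain ⟨h1, h2⟩ := hRc i j w hij hi hj
    rw [IH _ _ (hμ _ _ hi) h1, IH _ _ (hμ _ _ hj) h2, hTc _ _ _ hij, mul_assoc, mul_assoc,
      hσc _ _ hij]
  -- Neighbouring generators close a hexagon three steps below `w`, through the braid relation.
  have near : ∀ i, R i w → R (i + 1) w →
      T i (F (w * σ i)) = T (i + 1) (F (w * σ (i + 1))) := by
    intro i hi hj
    obtain ⟨h1, h2, h3, h4⟩ := hRb i w hi hj
    have l1 := hμ _ _ hi
    have l2 := hμ _ _ hj
    rw [IH _ _ l1 h1, IH _ _ ((hμ _ _ h1).trans l1) h2, IH _ _ l2 h3,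
      IH _ _ ((hμ _ _ h3).trans l2) h4, hTb]
    have := hσb i
    rw [mul_assoc, mul_assoc] at this
    simp only [mul_assoc, this]
  obtain ⟨j, hj, e⟩ := hF w ⟨i, hi⟩
  rw [e]
  rcases lt_trichotomy i j with h | h | h
  · rcases (PNat.add_one_le_iff.2 h).eq_or_lt with h' | h'
    · subst h'; exact (near i hi hj).symm
    · exact (far i j h' hi hj).symm
  · rw [h]
  · rcases (PNat.add_one_le_iff.2 h).eq_or_lt with h' | h'
    · subst h'; exact near j hj hi
    · exact far j i h' hj hi

theorem mul_swap_apply_self (w : Equiv.Perm ℕ+) (i j : ℕ+) : (w * Equiv.swap i j) i = w j := by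
  simp

theorem mul_swap_apply_right (w : Equiv.Perm ℕ+) (i j : ℕ+) : (w * Equiv.swap i j) j = w i := by
  simp

theorem mul_swap_apply_of_ne (w : Equiv.Perm ℕ+) {i j k : ℕ+} (h1 : k ≠ i) (h2 : k ≠ j) :
    (w * Equiv.swap i j) k = w k := by
  rw [Equiv.Perm.mul_apply, Equiv.swap_apply_of_ne_of_ne h1 h2]

theorem mul_swap_far_left (w : Equiv.Perm ℕ+) {i j : ℕ+} (h : i + 1 < j) :
    (w * Equiv.swap i (i + 1)) j = w j ∧ (w * Equiv.swap i (i + 1)) (j + 1) = w (j + 1) ∧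
    (w * Equiv.swap j (j + 1)) i = w i ∧ (w * Equiv.swap j (j + 1)) (i + 1) = w (i + 1) := by
  have hi : i < i + 1 := PNat.lt_add_right i 1
  have hj : j < j + 1 := PNat.lt_add_right j 1
  exact ⟨mul_swap_apply_of_ne _ (hi.trans h).ne' h.ne',
    mul_swap_apply_of_ne _ (hi.trans (h.trans hj)).ne' (h.trans hj).ne',
    mul_swap_apply_of_ne _ (hi.trans h).ne (hi.trans (h.trans hj)).ne,
    mul_swap_apply_of_ne _ h.ne (h.trans hj).ne⟩

theorem mul_swap_near (w : Equiv.Perm ℕ+) (i : ℕ+) :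
    (w * Equiv.swap i (i + 1)) (i + 1 + 1) = w (i + 1 + 1) ∧
    (w * Equiv.swap (i + 1) (i + 1 + 1)) i = w i := by
  have h1 : i < i + 1 := PNat.lt_add_right i 1
  have h2 : i + 1 < i + 1 + 1 := PNat.lt_add_right (i + 1) 1
  exact ⟨mul_swap_apply_of_ne _ (h1.trans h2).ne' h2.ne',
    mul_swap_apply_of_ne _ h1.ne (h1.trans h2).ne⟩

theorem schubertIn_eq (n : ℕ) (w : Equiv.Perm ℕ+) (i : ℕ+) (hi : (i : ℕ) < n)
    (h : w i < w (i + 1)) :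
    schubertIn n w = ddLin i (schubertIn n (w * Equiv.swap i (i + 1))) := by
  refine eq_of_exists_eq (fun i => Equiv.swap i (i + 1)) (fun i f => ddLin i f)
    (fun i j h => swap_comm_of_lt h) swap_braid (fun i j m h => ddLin_comm h m)
    (fun i m => ddLin_braid i m)
    (fun i w => (i : ℕ) < n ∧ w i < w (i + 1))
    (fun w => ∑ a ∈ Finset.range n, (a + 1) * (w a.succPNat : ℕ))
    (fun i w h => weight_mul_swap_lt n w i h.1 h.2) ?_ ?_ (schubertIn n) ?_ w i ⟨hi, h⟩
  · intro i j w hij hi hj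
    obtain ⟨h1, h2, h3, h4⟩ := mul_swap_far_left w hij
    exact ⟨⟨hj.1, by rw [h1, h2]; exact hj.2⟩, ⟨hi.1, by rw [h3, h4]; exact hi.2⟩⟩
  · intro i w hi hj
    obtain ⟨h1, h2⟩ := mul_swap_near w i
    obtain ⟨-, h2'⟩ := mul_swap_near (w * Equiv.swap i (i + 1)) i
    obtain ⟨h1', -⟩ := mul_swap_near (w * Equiv.swap (i + 1) (i + 1 + 1)) i
    refine ⟨⟨hj.1, ?_⟩, ⟨hi.1, ?_⟩, ⟨hi.1, ?_⟩, ⟨hj.1, ?_⟩⟩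
    · rw [mul_swap_apply_right, h1]; exact hi.2.trans hj.2
    · rw [mul_swap_apply_self, h2', mul_swap_apply_self, h1]; exact hj.2
    · rw [mul_swap_apply_self, h2]; exact hi.2.trans hj.2
    · rw [mul_swap_apply_right, h1', mul_swap_apply_right, h2]; exact hi.2
  · intro w hw
    refine ⟨hw.choose, hw.choose_spec, ?_⟩
    rw [schubertIn, dif_pos hw]
    rfl

theorem schubertIn_of_forall (n : ℕ) (w : Equiv.Perm ℕ+)
    (h : ∀ i : ℕ+, (i : ℕ) < n → w (i + 1) ≤ w i) : schubertIn n w = staircase n := by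
  rw [schubertIn, dif_neg]
  rintro ⟨i, hi, hw⟩
  exact (h i hi).not_gt hw

/-! ### Independence of the ambient `S_n` -/

/-- A permutation in `S_n` fixes everything above `n`. -/
def FixesAbove (n : ℕ) (w : Equiv.Perm ℕ+) : Prop := ∀ i : ℕ+, n < (i : ℕ) → w i = i

theorem FixesAbove.apply_le {n : ℕ} {w : Equiv.Perm ℕ+} (hw : FixesAbove n w) {i : ℕ+}
    (hi : (i : ℕ) ≤ n) : (w i : ℕ) ≤ n := by
  by_contra! h
  rw [w.injective (hw _ h)] at h
  omega

theorem FixesAbove.mono {m n : ℕ} (h : m ≤ n) {w : Equiv.Perm ℕ+} (hw : FixesAbove m w) :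
    FixesAbove n w := fun i hi => hw i (h.trans_lt hi)

theorem FixesAbove.mul {n : ℕ} {v w : Equiv.Perm ℕ+} (hv : FixesAbove n v) (hw : FixesAbove n w) :
    FixesAbove n (v * w) := fun i hi => by rw [Equiv.Perm.mul_apply, hw i hi, hv i hi]

theorem fixesAbove_swap {n : ℕ} {i : ℕ+} (hi : (i : ℕ) < n) :
    FixesAbove n (Equiv.swap i (i + 1)) := fun j hj => by
  apply Equiv.swap_apply_of_ne_of_ne <;> rintro rfl
  · omega
  · rw [PNat.add_coe, PNat.one_coe] at hj; omega

/-- The long element of `S_n` is characterized by having no ascent. -/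
theorem FixesAbove.apply_add_of_forall {n : ℕ} {w : Equiv.Perm ℕ+} (hw : FixesAbove n w)
    (h : ∀ i : ℕ+, (i : ℕ) < n → w (i + 1) ≤ w i) (a : ℕ) (ha : a < n) :
    (w a.succPNat : ℕ) + a = n := by
  -- The quantity `w(a) + a` is weakly decreasing, at most `n` at the left end and at least `n` at
  -- the right end, hence constantly `n`.
  have step : ∀ a, a + 1 < n →
      (w (a + 1).succPNat : ℕ) + (a + 1) ≤ (w a.succPNat : ℕ) + a := by
    intro a ha
    have h1 := h a.succPNat (by simpa using ha)
    rw [succPNat_add_one] at h1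
    have h2 : w (a + 1).succPNat ≠ w a.succPNat := fun e => by
      have := Nat.succPNat_injective (w.injective e); omega
    have h3 : (w (a + 1).succPNat : ℕ) < (w a.succPNat : ℕ) := by
      exact_mod_cast lt_of_le_of_ne h1 h2
    omega
  have anti : ∀ b a, a ≤ b → b < n → (w b.succPNat : ℕ) + b ≤ (w a.succPNat : ℕ) + a := by
    intro b
    induction b with
    | zero => intro a ha _; obtain rfl : a = 0 := by omega
              exact le_rfl
    | succ b ih =>
      intro a hab hb
      rcases hab.eq_or_lt with rfl | hab
      · exact le_rfl
      · exact (step b hb).trans (ih a (by omega) (by omega))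
  have h0 := anti a 0 (Nat.zero_le _) ha
  have h1 := anti (n - 1) a (by omega) (by omega)
  have h2 : (w (Nat.succPNat 0) : ℕ) ≤ n := hw.apply_le (by simp; omega)
  have h3 := (w (n - 1).succPNat).pos
  omega

/-- Schubert polynomials of the permutations between the long elements of `S_{n+1}` and `S_n`. -/
theorem schubertIn_succ_of_insert (n k : ℕ) (hk : k ≤ n) (w : Equiv.Perm ℕ+)
    (h1 : ∀ a < k, (w a.succPNat : ℕ) + a = n) (h2 : (w k.succPNat : ℕ) = n + 1)
    (h3 : ∀ a, k < a → a ≤ n → (w a.succPNat : ℕ) + a = n + 1) :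
    schubertIn (n + 1) w = Schubert.mono (n + 1) fun a => if a < k then n - 1 - a else n - a := by
  -- In one-line notation `w` is `n, …, n-k+1, n+1, n-k, …, 1`. Each step moves `n+1` one place to
  -- the left, ending at the long element of `S_{n+1}`; the corresponding divided difference lowers
  -- one exponent by 1.
  induction k generalizing w with
  | zero =>
    rw [schubertIn_of_forall, staircase_eq_mono]
    · simp
    · intro i hi
      obtain ⟨a, rfl⟩ : ∃ a : ℕ, i = a.succPNat := ⟨i.natPred, (PNat.succPNat_natPred i).symm⟩
      rw [succPNat_add_one, ← PNat.coe_le_coe]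
      have ha : a + 1 < n + 1 := by simpa using hi
      have := h3 (a + 1) (by omega) (by omega)
      rcases Nat.eq_zero_or_pos a with rfl | ha'
      · omega
      · have := h3 a ha' (by omega)
        omega
  | succ k ih =>
    have hk1 := h1 k (by omega)
    rw [schubertIn_eq (n + 1) w k.succPNat (by simp; omega), ih (by omega), ddLin_mono (by omega)]
    · congr 1
      ext a
      rcases eq_or_ne a k with rfl | ha
      · rw [Function.update_self]; simp; omega
      · rw [Function.update_of_ne ha]
        split_ifs <;> omega
    · simp; omega
    · intro a ha
      rw [succPNat_add_one, mul_swap_apply_of_ne]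
      · exact h1 a (by omega)
      · exact fun h => by have := Nat.succPNat_injective h; omega
      · exact fun h => by have := Nat.succPNat_injective h; omega
    · rw [mul_swap_apply_self, succPNat_add_one]; exact h2
    · intro a ha ha'
      rw [succPNat_add_one]
      rcases eq_or_ne a (k + 1) with rfl | hne
      · rw [mul_swap_apply_right]; omega
      · rw [mul_swap_apply_of_ne]
        · exact h3 a (by omega) ha'
        · exact fun h => by have := Nat.succPNat_injective h; omega
        · exact fun h => hne (Nat.succPNat_injective h)
    · rw [succPNat_add_one, ← PNat.coe_lt_coe]; omega

/-- Both sides obey the same recursion at ascents below `n`, so only the long element of `S_n` has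
to be compared. -/
theorem schubertIn_succ (n : ℕ) (w : Equiv.Perm ℕ+) (hw : FixesAbove n w) :
    schubertIn (n + 1) w = schubertIn n w := by
  induction hm : ∑ a ∈ Finset.range n, (a + 1) * (w a.succPNat : ℕ)
    using Nat.strong_induction_on generalizing w with
  | _ m ih =>
  by_cases h : ∃ i : ℕ+, (i : ℕ) < n ∧ w i < w (i + 1)
  · obtain ⟨i, hi, h⟩ := h
    rw [schubertIn_eq n w i hi h, schubertIn_eq (n + 1) w i (by omega) h,
      ih _ (hm ▸ weight_mul_swap_lt n w i hi h) _ (hw.mul (fixesAbove_swap hi)) rfl]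
  · push Not at h
    rw [schubertIn_of_forall n w h, schubertIn_succ_of_insert n n le_rfl w]
    · rw [Schubert.mono, Finset.prod_range_succ, staircase_eq_mono, Schubert.mono]
      simp only [lt_irrefl, if_false, Nat.sub_self, pow_zero, mul_one]
      exact Finset.prod_congr rfl fun a ha => by rw [if_pos (Finset.mem_range.1 ha)]
    · exact hw.apply_add_of_forall h
    · rw [hw _ (by simp)]; simp
    · intro a h1 h2; omega

theorem schubertIn_eq_of_le {m n : ℕ} (h : m ≤ n) (w : Equiv.Perm ℕ+) (hw : FixesAbove m w) :
    schubertIn n w = schubertIn m w := by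
  induction n, h using Nat.le_induction with
  | base => rfl
  | succ n h ih => rw [schubertIn_succ n w (hw.mono h), ih]

open Classical in
theorem schubert_eq {n : ℕ} (w : SInfty) (hw : FixesAbove n w) :
    schubert w = schubertIn n w :=
  (schubertIn_eq_of_le (Nat.find_min' (exists_bound w) hw) _ (Nat.find_spec (exists_bound w))).symm

/-! ### Divided differences of Schubert polynomials -/

theorem coe_s (i : ℕ+) : (s i : Equiv.Perm ℕ+) = Equiv.swap i (i + 1) := rfl

theorem s_mul_s (i : ℕ+) : s i * s i = 1 := Subtype.ext (by simp [coe_s])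

theorem mul_s_mul_s (w : SInfty) (i : ℕ+) : w * s i * s i = w := by rw [mul_assoc, s_mul_s, mul_one]

theorem s_mul_s_mul (w : SInfty) (i : ℕ+) : s i * (s i * w) = w := by
  rw [← mul_assoc, s_mul_s, one_mul]

theorem coe_mul_s (w : SInfty) (i : ℕ+) :
    ((w * s i : SInfty) : Equiv.Perm ℕ+) = w * Equiv.swap i (i + 1) := rfl

theorem ddLin_schubert_of_gt (w : SInfty) (i : ℕ+)
    (h : (w : Equiv.Perm ℕ+) (i + 1) < (w : Equiv.Perm ℕ+) i) :
    ddLin i (schubert w) = schubert (w * s i) := by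
  obtain ⟨m, hm⟩ := exists_bound w
  have hn : FixesAbove (m + i + 1) (w : Equiv.Perm ℕ+) := FixesAbove.mono (by omega) hm
  have hi : (i : ℕ) < m + i + 1 := by omega
  rw [schubert_eq w hn, schubert_eq (w * s i) (hn.mul (fixesAbove_swap hi)),
    schubertIn_eq _ (w * s i : SInfty) i hi, ← coe_mul_s, mul_s_mul_s]
  rw [coe_mul_s, mul_swap_apply_self, mul_swap_apply_right]
  exact h

/-- At an ascent `𝔖_w` is itself in the image of `∂_i`, and `∂_i² = 0`. -/
theorem ddLin_schubert_of_lt (w : SInfty) (i : ℕ+)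
    (h : (w : Equiv.Perm ℕ+) i < (w : Equiv.Perm ℕ+) (i + 1)) :
    ddLin i (schubert w) = 0 := by
  have := ddLin_schubert_of_gt (w * s i) i (by
    rw [coe_mul_s, mul_swap_apply_self, mul_swap_apply_right]; exact h)
  rw [mul_s_mul_s] at this
  rw [← this, ddLin_ddLin]

theorem schubert_one : schubert 1 = 1 := by
  rw [schubert_eq (n := 0) 1 fun i _ => rfl, schubertIn_of_forall _ _ (by simp)]
  simp [staircase]

/-! ### Inversions, Coxeter length and Bruhat order -/

/-- The set of inversions of a permutation. -/
def inversions (w : Equiv.Perm ℕ+) : Set (ℕ+ × ℕ+) := {p | p.1 < p.2 ∧ w p.2 < w p.1}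

/-- The number of inversions. -/
def inv (w : SInfty) : ℕ := (inversions w).ncard

theorem finite_inversions (w : SInfty) : (inversions w).Finite := by
  obtain ⟨n, hn⟩ := exists_bound w
  refine ((Set.finite_Iic n.succPNat).prod (Set.finite_Iic n.succPNat)).subset ?_
  rintro ⟨p, q⟩ ⟨h1, h2⟩
  simp only at h1 h2
  have hq : (q : ℕ) ≤ n := by
    by_contra! hq
    rw [hn q hq] at h2
    have h3 : n < ((w : Equiv.Perm ℕ+) p : ℕ) := hq.trans (by exact_mod_cast h2)
    have h4 := (w : Equiv.Perm ℕ+).injective (hn _ h3)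
    rw [h4] at h2
    exact h1.not_gt h2
  have h1' : (p : ℕ) < q := by exact_mod_cast h1
  constructor <;> simp only [Set.mem_Iic, ← PNat.coe_le_coe, Nat.succPNat_coe] <;> omega

theorem swap_lt_swap {i p q : ℕ+} (h : p < q) (hne : ¬(p = i ∧ q = i + 1)) :
    Equiv.swap i (i + 1) p < Equiv.swap i (i + 1) q := by
  rw [Equiv.swap_apply_def, Equiv.swap_apply_def]
  simp only [← PNat.coe_lt_coe, ← PNat.coe_inj, PNat.add_coe, PNat.one_coe] at *
  split_ifs <;> (try simp only [PNat.add_coe, PNat.one_coe]) <;> omega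

/-- The swap `s_i` preserves the order of every pair except `(i, i+1)`, so exactly that pair is
gained. -/
theorem inversions_mul_s (w : SInfty) (i : ℕ+)
    (h : (w : Equiv.Perm ℕ+) i < (w : Equiv.Perm ℕ+) (i + 1)) :
    inversions (w * s i : SInfty) = insert (i, i + 1)
      (Prod.map (Equiv.swap i (i + 1)) (Equiv.swap i (i + 1)) '' inversions w) := by
  ext ⟨p, q⟩
  simp only [inversions, Set.mem_ofPred_eq, Set.mem_insert_iff, Prod.mk.injEq, Set.mem_image,
    Prod.exists, Prod.map_apply, coe_mul_s, Equiv.Perm.mul_apply]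
  constructor
  · rintro ⟨h1, h2⟩
    by_cases hpq : p = i ∧ q = i + 1
    · exact Or.inl hpq
    · exact Or.inr ⟨_, _, ⟨swap_lt_swap h1 hpq, h2⟩, by simp, by simp⟩
  · rintro (⟨rfl, rfl⟩ | ⟨a, b, ⟨h1, h2⟩, rfl, rfl⟩)
    · exact ⟨PNat.lt_add_right p 1, by simpa using h⟩
    · refine ⟨swap_lt_swap h1 ?_, by simpa using h2⟩
      rintro ⟨rfl, rfl⟩
      exact h.not_gt h2

theorem inv_mul_s_of_lt (w : SInfty) (i : ℕ+)
    (h : (w : Equiv.Perm ℕ+) i < (w : Equiv.Perm ℕ+) (i + 1)) : inv (w * s i) = inv w + 1 := by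
  rw [inv, inversions_mul_s w i h, Set.ncard_insert_of_notMem _ ((finite_inversions w).image _),
    Set.ncard_image_of_injective _ ((Equiv.injective _).prodMap (Equiv.injective _)), inv]
  rintro ⟨⟨a, b⟩, ⟨h1, -⟩, h2⟩
  simp only [Prod.map_apply, Prod.mk.injEq] at h2 h1
  have ha : a = i + 1 := by rw [Equiv.swap_apply_eq_iff, Equiv.swap_apply_left] at h2; exact h2.1
  have hb : b = i := by
    have := h2.2; rw [Equiv.swap_apply_eq_iff, Equiv.swap_apply_right] at this; exact this
  rw [ha, hb] at h1
  exact h1.not_gt (PNat.lt_add_right i 1)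

theorem inv_mul_s_of_gt (w : SInfty) (i : ℕ+)
    (h : (w : Equiv.Perm ℕ+) (i + 1) < (w : Equiv.Perm ℕ+) i) : inv (w * s i) + 1 = inv w := by
  have := inv_mul_s_of_lt (w * s i) i (by
    rw [coe_mul_s, mul_swap_apply_self, mul_swap_apply_right]; exact h)
  rw [mul_s_mul_s] at this
  exact this.symm

theorem apply_lt_or_gt (w : SInfty) (i : ℕ+) :
    (w : Equiv.Perm ℕ+) i < (w : Equiv.Perm ℕ+) (i + 1) ∨
      (w : Equiv.Perm ℕ+) (i + 1) < (w : Equiv.Perm ℕ+) i :=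
  lt_or_gt_of_ne fun h => (PNat.lt_add_right i 1).ne ((w : Equiv.Perm ℕ+).injective h)

theorem inv_one : inv 1 = 0 := by
  have : inversions (1 : SInfty) = ∅ := by
    ext ⟨p, q⟩
    simp only [inversions, Set.mem_ofPred_eq, Set.mem_empty_iff_false, iff_false, not_and]
    exact fun h => h.not_gt
  rw [inv, this, Set.ncard_empty]

theorem inv_inv (w : SInfty) : inv w⁻¹ = inv w := by
  have : inversions (w⁻¹ : SInfty)
      = (fun p : ℕ+ × ℕ+ => ((w : Equiv.Perm ℕ+) p.2, (w : Equiv.Perm ℕ+) p.1)) ''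
        inversions w := by
    ext ⟨p, q⟩
    simp only [inversions, Set.mem_ofPred_eq, Set.mem_image, Prod.exists, Prod.mk.injEq]
    constructor
    · rintro ⟨h1, h2⟩
      exact ⟨_, _, ⟨h2, by simpa using h1⟩, by simp, by simp⟩
    · rintro ⟨a, b, ⟨h1, h2⟩, rfl, rfl⟩
      exact ⟨h2, by simpa using h1⟩
  rw [inv, this, Set.ncard_image_of_injective, inv]
  rintro ⟨a, b⟩ ⟨c, d⟩ h
  simp only [Prod.mk.injEq, EmbeddingLike.apply_eq_iff_eq] at h
  rw [h.1, h.2]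

theorem exists_descent {w : SInfty} (hw : w ≠ 1) :
    ∃ i, (w : Equiv.Perm ℕ+) (i + 1) < (w : Equiv.Perm ℕ+) i := by
  by_contra! h
  refine hw (Subtype.ext (Equiv.ext fun i => ?_))
  have lt : ∀ i, (w : Equiv.Perm ℕ+) i < (w : Equiv.Perm ℕ+) (i + 1) := fun i =>
    (apply_lt_or_gt w i).resolve_right (h i).not_gt
  -- Without descents the permutation is an order automorphism of `ℕ+`, and the identity is the only
  -- one.
  have hm : StrictMono (w : Equiv.Perm ℕ+) := strictMono_of_lt_add_one fun i _ => lt i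
  exact DFunLike.congr_fun (Subsingleton.elim (hm.orderIsoOfSurjective _
    (w : Equiv.Perm ℕ+).surjective) (OrderIso.refl ℕ+)) i

theorem inv_prod_le (a : List ℕ+) : inv (a.map s).prod ≤ a.length := by
  induction a using List.reverseRecOn with
  | nil => simp [inv_one]
  | append_singleton a i ih =>
    rw [List.map_append, List.prod_append, List.length_append]
    simp only [List.map_cons, List.map_nil, List.prod_singleton, List.length_singleton]
    rcases apply_lt_or_gt (a.map s).prod i with h | h
    · rw [inv_mul_s_of_lt _ _ h]; omega
    · have := inv_mul_s_of_gt _ _ h; omega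

theorem exists_word (w : SInfty) : ∃ a : List ℕ+, a.length = inv w ∧ (a.map s).prod = w := by
  induction hm : inv w using Nat.strong_induction_on generalizing w with
  | _ m ih =>
  by_cases hw : w = 1
  · subst hw
    exact ⟨[], by rw [← hm, inv_one]; rfl, rfl⟩
  · obtain ⟨i, hi⟩ := exists_descent hw
    have h := inv_mul_s_of_gt w i hi
    obtain ⟨a, ha, hw⟩ := ih (inv (w * s i)) (by omega) (w * s i) rfl
    refine ⟨a ++ [i], by simp; omega, ?_⟩
    rw [List.map_append, List.prod_append, hw]
    simp [mul_s_mul_s]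

theorem length_eq_inv (w : SInfty) : length w = inv w := by
  refine le_antisymm (Nat.sInf_le (exists_word w)) ?_
  obtain ⟨a, ha, hw⟩ := Nat.sInf_mem (s := {l : ℕ | ∃ a : List ℕ+, a.length = l ∧
    (a.map s).prod = w}) ⟨_, exists_word w⟩
  rw [length, ← ha, ← hw]
  exact inv_prod_le a

theorem s_inv (i : ℕ+) : (s i)⁻¹ = s i := inv_eq_of_mul_eq_one_left (s_mul_s i)

theorem inv_s_mul_of_lt (w : SInfty) (k : ℕ+)
    (h : (w⁻¹ : Equiv.Perm ℕ+) k < (w⁻¹ : Equiv.Perm ℕ+) (k + 1)) : inv (s k * w) = inv w + 1 := by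
  rw [← inv_inv, mul_inv_rev, s_inv, ← inv_inv w]
  exact inv_mul_s_of_lt _ _ h

theorem isLeftDescent_or (w : SInfty) (k : ℕ+) :
    (w⁻¹ : Equiv.Perm ℕ+) k < (w⁻¹ : Equiv.Perm ℕ+) (k + 1) ∨ IsLeftDescent w k :=
  apply_lt_or_gt w⁻¹ k

theorem isLeftDescent_s_mul {w : SInfty} {k : ℕ+} :
    IsLeftDescent (s k * w) k ↔ ¬ IsLeftDescent w k := by
  rw [IsLeftDescent, IsLeftDescent, not_lt]
  have : ((s k * w : SInfty) : Equiv.Perm ℕ+)⁻¹ = (w : Equiv.Perm ℕ+)⁻¹ * Equiv.swap k (k + 1) := by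
    rw [Subgroup.coe_mul, mul_inv_rev, coe_s, Equiv.swap_inv]
  rw [this, mul_swap_apply_self, mul_swap_apply_right]
  exact ⟨le_of_lt, fun h => lt_of_le_of_ne h fun e =>
    (PNat.lt_add_right k 1).ne ((w : Equiv.Perm ℕ+)⁻¹.injective e)⟩

theorem BruhatLT.length_lt {a b : SInfty} (h : BruhatLT a b) : length a < length b := by
  induction h with
  | single h => have := h.2; omega
  | tail _ h ih => have := h.2; omega

/-- At an ascent, conjugating `s_k` by `w` rewrites `s_k w` as `w` times a transposition, which is a
cover. At a descent the length drops, which excludes `w < s_k w`. -/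
theorem bruhatLT_s_mul_iff (w : SInfty) (k : ℕ+) :
    BruhatLT w (s k * w) ↔ ¬ IsLeftDescent w k := by
  constructor
  · intro h hd
    have h1 := h.length_lt
    have h2 := isLeftDescent_s_mul (w := s k * w) (k := k)
    rw [s_mul_s_mul] at h2
    have h3 := inv_s_mul_of_lt (s k * w) k ((isLeftDescent_or _ _).resolve_right (h2.1 hd))
    rw [s_mul_s_mul] at h3
    rw [length_eq_inv, length_eq_inv] at h1
    omega
  · intro h
    refine Relation.TransGen.single ⟨⟨(w⁻¹ : Equiv.Perm ℕ+) k, (w⁻¹ : Equiv.Perm ℕ+) (k + 1),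
      fun e => (PNat.lt_add_right k 1).ne ((w : Equiv.Perm ℕ+)⁻¹.injective e), ?_⟩, ?_⟩
    · refine Subtype.ext ?_
      change (w : Equiv.Perm ℕ+) = Equiv.swap k (k + 1) * (w : Equiv.Perm ℕ+) *
        Equiv.swap _ _
      rw [mul_assoc, Equiv.mul_swap_eq_swap_mul]
      simp [← mul_assoc]
    · rw [length_eq_inv, length_eq_inv,
        inv_s_mul_of_lt w k ((isLeftDescent_or _ _).resolve_right h)]

theorem eq_of_forall_le {n : ℕ} {v w : SInfty} (hv : FixesAbove n v) (hw : FixesAbove n w)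
    (hv' : ∀ i : ℕ+, (i : ℕ) < n → (v : Equiv.Perm ℕ+) (i + 1) ≤ (v : Equiv.Perm ℕ+) i)
    (hw' : ∀ i : ℕ+, (i : ℕ) < n → (w : Equiv.Perm ℕ+) (i + 1) ≤ (w : Equiv.Perm ℕ+) i) :
    v = w := by
  refine Subtype.ext (Equiv.ext fun i => ?_)
  obtain ⟨a, rfl⟩ : ∃ a : ℕ, i = a.succPNat := ⟨i.natPred, (PNat.succPNat_natPred i).symm⟩
  by_cases ha : a < n
  · have h1 := hv.apply_add_of_forall hv' a ha
    have h2 := hw.apply_add_of_forall hw' a ha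
    apply PNat.eq
    omega
  · have : n < (a.succPNat : ℕ) := by simp; omega
    rw [hv _ this, hw _ this]

/-! ### Homogeneity and constant terms -/

/-- The substitution `x_i ↦ 2 x_i`. -/
def scale : MvPolynomial ℕ+ ℤ →ₐ[ℤ] MvPolynomial ℕ+ ℤ := aeval fun i => 2 * X i

theorem scale_X (i : ℕ+) : scale (X i) = 2 * X i := aeval_X _ _

theorem scale_swapVars (i : ℕ+) (f : MvPolynomial ℕ+ ℤ) :
    scale (swapVars i f) = swapVars i (scale f) := by
  have : scale.comp (swapVars i) = (swapVars i).comp scale := by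
    ext1 j
    simp [swapVars, scale_X, map_ofNat (rename (Equiv.swap i (i + 1)))]
  exact DFunLike.congr_fun this f

theorem ddLin_scale (i : ℕ+) (f : MvPolynomial ℕ+ ℤ) :
    ddLin i (scale f) = 2 * scale (ddLin i f) := by
  refine ddLin_eq ?_
  rw [← scale_swapVars, ← map_sub, ← ddLin_spec, map_mul, map_sub, scale_X, scale_X]
  ring

theorem constantCoeff_scale (f : MvPolynomial ℕ+ ℤ) :
    constantCoeff (scale f) = constantCoeff f := by
  induction f using MvPolynomial.induction_on with
  | C a => simp [scale]
  | add p q hp hq => rw [map_add, map_add, map_add, hp, hq]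
  | mul_X p j _ => simp [scale_X]

theorem scale_staircase (n : ℕ) : ∃ d : ℕ, scale (staircase n) = 2 ^ d * staircase n := by
  refine ⟨∑ i ∈ Finset.range n, (n - 1 - i), ?_⟩
  rw [staircase, map_prod, ← Finset.prod_pow_eq_pow_sum, ← Finset.prod_mul_distrib]
  exact Finset.prod_congr rfl fun i _ => by rw [map_pow, scale_X, mul_pow]

theorem ddLin_two_pow_mul (i : ℕ+) (a : ℕ) (f : MvPolynomial ℕ+ ℤ) :
    ddLin i (2 ^ a * f) = 2 ^ a * ddLin i f := by
  have : ∀ g : MvPolynomial ℕ+ ℤ, 2 ^ a * g = (2 ^ a : ℤ) • g := fun g => by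
    rw [smul_eq_C_mul]; simp
  rw [this, map_smul, this]

/-- Homogeneity expressed through `x_i ↦ 2 x_i`: each divided difference costs a factor 2 and one
inversion. Here `v` is the long element of `S_n`; its inversion count stays on the left to avoid
subtraction. -/
theorem scale_schubertIn {n d : ℕ} (hd : scale (staircase n) = 2 ^ d * staircase n) (w : SInfty)
    (hw : FixesAbove n w) :
    ∃ v : SInfty, FixesAbove n v ∧
      (∀ i : ℕ+, (i : ℕ) < n → (v : Equiv.Perm ℕ+) (i + 1) ≤ (v : Equiv.Perm ℕ+) i) ∧
      2 ^ inv v * scale (schubertIn n w) = 2 ^ (d + inv w) * schubertIn n w := by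
  induction hm : ∑ a ∈ Finset.range n, (a + 1) * ((w : Equiv.Perm ℕ+) a.succPNat : ℕ)
    using Nat.strong_induction_on generalizing w with
  | _ m ih =>
  by_cases h : ∃ i : ℕ+, (i : ℕ) < n ∧ (w : Equiv.Perm ℕ+) i < (w : Equiv.Perm ℕ+) (i + 1)
  · obtain ⟨i, hi, h⟩ := h
    obtain ⟨v, hv, hv', e⟩ := ih _ (hm ▸ weight_mul_swap_lt n w i hi h) (w * s i)
      (hw.mul (fixesAbove_swap hi)) rfl
    refine ⟨v, hv, hv', ?_⟩
    have e' := congrArg (ddLin i) e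
    rw [ddLin_two_pow_mul, ddLin_two_pow_mul, ddLin_scale, coe_mul_s, ← schubertIn_eq n w i hi h,
      inv_mul_s_of_lt w i h] at e'
    refine mul_left_cancel₀ (two_ne_zero (α := MvPolynomial ℕ+ ℤ)) ?_
    linear_combination e'
  · push Not at h
    refine ⟨w, hw, h, ?_⟩
    rw [schubertIn_of_forall n w h, hd]
    ring

theorem inv_pos {w : SInfty} (hw : w ≠ 1) : 0 < inv w := by
  obtain ⟨i, hi⟩ := exists_descent hw
  have := inv_mul_s_of_gt w i hi
  omega

theorem constantCoeff_schubert_of_ne_one {w : SInfty} (hw : w ≠ 1) :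
    constantCoeff (schubert w) = 0 := by
  obtain ⟨n, hn⟩ := exists_bound w
  have h1 : FixesAbove n (1 : SInfty) := fun _ _ => rfl
  obtain ⟨d, hd⟩ := scale_staircase n
  obtain ⟨v, hv, hv', e⟩ := scale_schubertIn hd w hn
  obtain ⟨v', hu, hu', e'⟩ := scale_schubertIn hd 1 h1
  obtain rfl := eq_of_forall_le hv hu hv' hu'
  rw [← schubert_eq _ h1, schubert_one, map_one, inv_one] at e'
  rw [← schubert_eq _ hn] at e
  have e2 := congrArg constantCoeff e
  have e2' := congrArg constantCoeff e'
  simp only [map_mul, map_pow, constantCoeff_scale, mul_one, add_zero, map_ofNat]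
    at e2 e2'
  -- The case `w = 1` gave `2 ^ inv v = 2 ^ d`, so the constant term is multiplied by `2 ^ inv w >
  -- 1` yet unchanged, hence 0.
  rw [e2', pow_add, mul_assoc] at e2
  have e3 := mul_left_cancel₀ (pow_ne_zero d (two_ne_zero (α := ℤ))) e2
  have h2 : (1 : ℤ) < 2 ^ inv w := one_lt_pow₀ one_lt_two (inv_pos hw).ne'
  have : (2 ^ inv w - 1 : ℤ) * constantCoeff (schubert w) = 0 := by linear_combination -e3
  exact (mul_eq_zero.1 this).resolve_left (by omega)

/-! ### Dual functionals and uniqueness of expansions -/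

/-- The functional `f ↦ (∂_w f)(0)`, where `∂_w` is the iterated divided difference. -/
def coeffFun (w : SInfty) : MvPolynomial ℕ+ ℤ →ₗ[ℤ] ℤ :=
  open Classical in
  if h : ∃ i, (w : Equiv.Perm ℕ+) (i + 1) < (w : Equiv.Perm ℕ+) i then
    (coeffFun (w * s h.choose)).comp (ddLin h.choose)
  else (constantCoeff (σ := ℕ+) (R := ℤ)).toAddMonoidHom.toIntLinearMap
termination_by inv w
decreasing_by have := inv_mul_s_of_gt w _ h.choose_spec; omega

theorem s_comm {i j : ℕ+} (h : i + 1 < j) : s i * s j = s j * s i :=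
  Subtype.ext (swap_comm_of_lt h)

theorem s_braid (i : ℕ+) : s i * s (i + 1) * s i = s (i + 1) * s i * s (i + 1) :=
  Subtype.ext (swap_braid i)

theorem coeffFun_eq (w : SInfty) (i : ℕ+)
    (h : (w : Equiv.Perm ℕ+) (i + 1) < (w : Equiv.Perm ℕ+) i) :
    coeffFun w = (coeffFun (w * s i)).comp (ddLin i) := by
  refine eq_of_exists_eq s (fun i φ => φ.comp (ddLin i)) (fun i j h => s_comm h) s_braid
    (fun i j φ h => LinearMap.ext fun f => congrArg φ (ddLin_comm h f).symm)
    (fun i φ => LinearMap.ext fun f => congrArg φ (ddLin_braid i f))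
    (fun i w => (w : Equiv.Perm ℕ+) (i + 1) < (w : Equiv.Perm ℕ+) i) inv
    (fun i w h => by have := inv_mul_s_of_gt w i h; omega) ?_ ?_ coeffFun ?_ w i h
  · intro i j w hij hi hj
    obtain ⟨h1, h2, h3, h4⟩ := mul_swap_far_left (w : Equiv.Perm ℕ+) hij
    simp only [coe_mul_s]
    exact ⟨by rw [h1, h2]; exact hj, by rw [h3, h4]; exact hi⟩
  · intro i w hi hj
    obtain ⟨h1, h2⟩ := mul_swap_near (w : Equiv.Perm ℕ+) i
    obtain ⟨-, h2'⟩ := mul_swap_near ((w : Equiv.Perm ℕ+) * Equiv.swap i (i + 1)) i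
    obtain ⟨h1', -⟩ := mul_swap_near ((w : Equiv.Perm ℕ+) * Equiv.swap (i + 1) (i + 1 + 1)) i
    simp only [coe_mul_s]
    refine ⟨?_, ?_, ?_, ?_⟩
    · rw [mul_swap_apply_right, h1]; exact hj.trans hi
    · rw [mul_swap_apply_self, h2', mul_swap_apply_self, h1]; exact hj
    · rw [mul_swap_apply_self, h2]; exact hj.trans hi
    · rw [mul_swap_apply_right, h1', mul_swap_apply_right, h2]; exact hi
  · intro w hw
    refine ⟨hw.choose, hw.choose_spec, ?_⟩
    rw [coeffFun, dif_pos hw]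

theorem coeffFun_apply_of_gt (w : SInfty) (i : ℕ+)
    (h : (w : Equiv.Perm ℕ+) (i + 1) < (w : Equiv.Perm ℕ+) i) (f : MvPolynomial ℕ+ ℤ) :
    coeffFun w f = coeffFun (w * s i) (ddLin i f) := by
  rw [coeffFun_eq w i h]; rfl

theorem coeffFun_one (f : MvPolynomial ℕ+ ℤ) : coeffFun 1 f = constantCoeff f := by
  rw [coeffFun, dif_neg]
  · rfl
  · rintro ⟨i, hi⟩
    exact hi.not_gt (PNat.lt_add_right i 1)

-- Peel off a descent `i` of `v`: either `w` also descends at `i` and both indices get multiplied by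
-- `s_i`, or `∂_i` kills `𝔖_w` and `w ≠ v`. The base case is the constant term.
open Classical in
theorem coeffFun_schubert (v w : SInfty) :
    coeffFun v (schubert w) = if w = v then 1 else 0 := by
  induction hm : inv v using Nat.strong_induction_on generalizing v w with
  | _ m ih =>
  by_cases hv : v = 1
  · subst hv
    rw [coeffFun_one]
    split_ifs with h
    · rw [h, schubert_one, map_one]
    · exact constantCoeff_schubert_of_ne_one h
  · obtain ⟨i, hi⟩ := exists_descent hv
    have h := inv_mul_s_of_gt v i hi
    rw [coeffFun_apply_of_gt v i hi]
    rcases apply_lt_or_gt w i with hw | hw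
    · rw [ddLin_schubert_of_lt w i hw, map_zero, if_neg]
      rintro rfl
      exact hw.not_gt hi
    · rw [ddLin_schubert_of_gt w i hw, ih _ (by omega) _ _ rfl]
      simp only [mul_left_inj]

theorem coeffFun_expansion {f : MvPolynomial ℕ+ ℤ} {c : SInfty →₀ ℤ}
    (h : IsSchubertExpansion f c) (w : SInfty) : coeffFun w f = c w := by
  classical
  rw [h, Finsupp.sum, map_sum]
  simp only [map_smul, coeffFun_schubert, smul_eq_mul, mul_ite, mul_one, mul_zero]
  rw [Finset.sum_ite_eq']
  split_ifs with hw
  · rfl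
  · exact (Finsupp.notMem_support_iff.1 hw).symm

theorem IsSchubertExpansion.unique {f : MvPolynomial ℕ+ ℤ} {c c' : SInfty →₀ ℤ}
    (h : IsSchubertExpansion f c) (h' : IsSchubertExpansion f c') : c = c' :=
  Finsupp.ext fun w => by rw [← coeffFun_expansion h, coeffFun_expansion h']

/-! ### Schubert polynomials span -/

/-- The span of the Schubert polynomials. -/
def schubertSpan : Submodule ℤ (MvPolynomial ℕ+ ℤ) := Submodule.span ℤ (Set.range schubert)

theorem mem_schubertSpan {f : MvPolynomial ℕ+ ℤ} :
    f ∈ schubertSpan ↔ ∃ c, IsSchubertExpansion f c := by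
  rw [schubertSpan, Finsupp.mem_span_range_iff_exists_finsupp]
  exact exists_congr fun c => eq_comm

theorem eq_of_coeffFun_eq {f g : MvPolynomial ℕ+ ℤ} (hf : f ∈ schubertSpan)
    (hg : g ∈ schubertSpan) (h : ∀ w, coeffFun w f = coeffFun w g) : f = g := by
  obtain ⟨c, hc⟩ := mem_schubertSpan.1 hf
  obtain ⟨c', hc'⟩ := mem_schubertSpan.1 hg
  obtain rfl : c = c' := Finsupp.ext fun w => by
    rw [← coeffFun_expansion hc, ← coeffFun_expansion hc', h]
  exact hc.trans hc'.symm

theorem ddLin_mem_schubertSpan (i : ℕ+) {f : MvPolynomial ℕ+ ℤ} (hf : f ∈ schubertSpan) :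
    ddLin i f ∈ schubertSpan := by
  have : schubertSpan ≤ schubertSpan.comap (ddLin i) := by
    refine Submodule.span_le.2 ?_
    rintro _ ⟨w, rfl⟩
    rw [SetLike.mem_coe, Submodule.mem_comap]
    rcases apply_lt_or_gt w i with hw | hw
    · rw [ddLin_schubert_of_lt w i hw]; exact zero_mem _
    · rw [ddLin_schubert_of_gt w i hw]; exact Submodule.subset_span ⟨_, rfl⟩
  exact this hf

theorem C_mem_schubertSpan (a : ℤ) : C a ∈ schubertSpan := by
  have : (C a : MvPolynomial ℕ+ ℤ) = a • schubert 1 := by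
    rw [schubert_one, smul_eq_C_mul, mul_one]
  rw [this]
  exact Submodule.smul_mem _ _ (Submodule.subset_span ⟨_, rfl⟩)

theorem finite_swapVars_ne (f : MvPolynomial ℕ+ ℤ) : {i : ℕ+ | swapVars i f ≠ f}.Finite := by
  induction f using MvPolynomial.induction_on with
  | C a => simp [swapVars]
  | add p q hp hq =>
    refine (hp.union hq).subset fun i hi => ?_
    by_contra h
    simp only [Set.mem_union, Set.mem_ofPred_eq, not_or, not_not] at h hi
    exact hi (by rw [map_add, h.1, h.2])
  | mul_X p j hp =>
    refine (hp.union ((Set.finite_singleton j).union (Set.finite_singleton (j - 1)))).subset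
      fun i hi => ?_
    by_contra h
    simp only [Set.mem_union, Set.mem_ofPred_eq, not_or, not_not, Set.mem_singleton_iff] at h hi
    refine hi ?_
    rw [map_mul, h.1, swapVars_X_of_ne (Ne.symm h.2.1)]
    rintro rfl
    exact h.2.2 (PNat.add_sub).symm

theorem finite_ddLin_ne_zero (f : MvPolynomial ℕ+ ℤ) : {i : ℕ+ | ddLin i f ≠ 0}.Finite :=
  (finite_swapVars_ne f).subset fun i hi h => hi (ddLin_eq (by rw [h, sub_self, mul_zero]))

theorem swapVars_eq_of_ddLin_eq_zero {i : ℕ+} {f : MvPolynomial ℕ+ ℤ} (h : ddLin i f = 0) :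
    swapVars i f = f := by
  have := ddLin_spec i f
  rw [h, mul_zero] at this
  exact (sub_eq_zero.1 this.symm).symm

/-- Such an `f` is invariant under all `s_i`, so its finite set of variables is closed under `i ↦ i
+ 1` and must be empty. -/
theorem eq_C_of_ddLin_eq_zero {f : MvPolynomial ℕ+ ℤ} (h : ∀ i, ddLin i f = 0) :
    f = C (f.coeff 0) := by
  rw [← vars_eq_empty_iff_eq_C]
  by_contra hne
  obtain ⟨j, hj⟩ := Finset.nonempty_iff_ne_empty.2 hne
  have step : ∀ i, i ∈ f.vars → i + 1 ∈ f.vars := by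
    intro i hi
    have h1 := vars_rename (Equiv.swap i (i + 1)) f
    have h2 := swapVars_eq_of_ddLin_eq_zero (h i)
    rw [swapVars] at h2
    rw [h2] at h1
    obtain ⟨k, hk, hk'⟩ := Finset.mem_image.1 (h1 hi)
    rw [Equiv.swap_apply_eq_iff, Equiv.swap_apply_left] at hk'
    exact hk' ▸ hk
  have hmax := Finset.le_max' f.vars _ (step _ (Finset.max'_mem f.vars ⟨j, hj⟩))
  exact hmax.not_gt (PNat.lt_add_right _ 1)

theorem totalDegree_ddLin_lt {i : ℕ+} {f : MvPolynomial ℕ+ ℤ} (h : ddLin i f ≠ 0) :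
    (ddLin i f).totalDegree < f.totalDegree := by
  have h1 : (X i - X (i + 1) : MvPolynomial ℕ+ ℤ).totalDegree ≠ 0 := by
    rw [Ne, totalDegree_eq_zero_iff_eq_C]
    intro e
    have := congrArg (coeff (Finsupp.single i 1)) e
    have hi : i + 1 ≠ i := (PNat.lt_add_right i 1).ne'
    simp [coeff_X, Finsupp.single_left_inj, hi] at this
  have h2 := totalDegree_mul_of_isDomain (X_sub_X_succ_ne_zero i) h
  rw [ddLin_spec] at h2
  have h3 := totalDegree_sub f (swapVars i f)
  have h4 : (swapVars i f).totalDegree ≤ f.totalDegree := totalDegree_rename_le _ _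
  rw [max_eq_left h4] at h3
  omega

theorem mem_schubertSpan_all (f : MvPolynomial ℕ+ ℤ) : f ∈ schubertSpan := by
  induction hm : f.totalDegree using Nat.strong_induction_on generalizing f with
  | _ m ih =>
  have hd : ∀ i, ddLin i f ∈ schubertSpan := fun i => by
    by_cases h : ddLin i f = 0
    · rw [h]; exact zero_mem _
    · exact ih _ (hm ▸ totalDegree_ddLin_lt h) _ rfl
  -- A nontrivial `w` with nonzero coefficient ends in a descent `i` with `∂_i f ≠ 0`; there are
  -- finitely many such `i`, and each `∂_i f` has a finite expansion by induction.
  have fin : (Function.support fun w => coeffFun w f).Finite := by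
    have hfin : ∀ i, {w | coeffFun w (ddLin i f) ≠ 0}.Finite := fun i => by
      obtain ⟨c, hc⟩ := mem_schubertSpan.1 (hd i)
      exact c.hasFiniteSupport.subset fun w hw => by
        rwa [Set.mem_ofPred_eq, coeffFun_expansion hc] at hw
    refine ((Set.finite_singleton 1).union ((finite_ddLin_ne_zero f).biUnion fun i _ =>
      (hfin i).image (· * s i))).subset fun w hw => ?_
    by_cases h1 : w = 1
    · exact Or.inl h1
    · obtain ⟨i, hi⟩ := exists_descent h1
      rw [Function.mem_support, coeffFun_apply_of_gt w i hi] at hw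
      refine Or.inr (Set.mem_biUnion (x := i) ?_ ⟨w * s i, hw, mul_s_mul_s w i⟩)
      intro h
      rw [h, map_zero] at hw
      exact hw rfl
  set c : SInfty →₀ ℤ := Finsupp.ofSupportFinite _ fin with hc
  set g := c.sum fun w a => a • schubert w with hg
  have hgs : g ∈ schubertSpan := mem_schubertSpan.2 ⟨c, rfl⟩
  have hgc : ∀ w, coeffFun w g = coeffFun w f := fun w => coeffFun_expansion (c := c) rfl w
  -- The candidate `g` has the same coefficients as `f`. At an ascent `i` of `w`, the
  -- `w`-coefficient of `∂_i f` is the `w s_i`-coefficient of `f`; at a descent it vanishes because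
  -- `∂_i² = 0`.
  have key : ∀ i, ddLin i (f - g) = 0 := fun i => by
    rw [map_sub, sub_eq_zero]
    refine eq_of_coeffFun_eq (hd i) (ddLin_mem_schubertSpan i hgs) fun w => ?_
    rcases apply_lt_or_gt w i with hw | hw
    · have hw' : ((w * s i : SInfty) : Equiv.Perm ℕ+) (i + 1)
          < ((w * s i : SInfty) : Equiv.Perm ℕ+) i := by
        rw [coe_mul_s, mul_swap_apply_self, mul_swap_apply_right]; exact hw
      have e := fun f => coeffFun_apply_of_gt (w * s i) i hw' f
      simp only [mul_s_mul_s] at e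
      rw [← e, ← e, hgc]
    · rw [coeffFun_apply_of_gt w i hw, coeffFun_apply_of_gt w i hw, ddLin_ddLin, ddLin_ddLin]
  rw [← sub_add_cancel f g]
  refine add_mem ?_ hgs
  rw [eq_C_of_ddLin_eq_zero key]
  exact C_mem_schubertSpan _

theorem existsUnique_expansion (f : MvPolynomial ℕ+ ℤ) :
    ∃! c : SInfty →₀ ℤ, IsSchubertExpansion f c := by
  obtain ⟨c, hc⟩ := mem_schubertSpan.1 (mem_schubertSpan_all f)
  exact ⟨c, hc, fun c' hc' => hc'.unique hc⟩

theorem isSchubertExpansion_structureCoeff (u v : SInfty) :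
    IsSchubertExpansion (schubert u * schubert v) (structureCoeff u v) := by
  have h := (existsUnique_expansion (schubert u * schubert v)).exists
  rw [structureCoeff, dif_pos h]
  exact h.choose_spec

/-! ### The expansion of `∇ 𝔖_w` -/

open Classical in
/-- The term of index `k` in the expansion of `∇ 𝔖_w`. -/
def nablaTerm (w : SInfty) (k : ℕ+) : MvPolynomial ℕ+ ℤ :=
  if IsLeftDescent w k then (k : ℤ) • schubert (s k * w) else 0

theorem inv_mul_s_apply (w : SInfty) (i k : ℕ+) :
    ((w * s i : SInfty) : Equiv.Perm ℕ+)⁻¹ k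
      = Equiv.swap i (i + 1) ((w : Equiv.Perm ℕ+)⁻¹ k) := by
  rw [coe_mul_s, mul_inv_rev, Equiv.swap_inv]; rfl

/-- Exchanging positions `i` and `i+1` changes the relative order of the values `k` and `k+1` only
when they occupy those two positions. -/
theorem isLeftDescent_mul_s_iff {w : SInfty} {i k : ℕ+}
    (h : ¬((w : Equiv.Perm ℕ+) i = k ∧ (w : Equiv.Perm ℕ+) (i + 1) = k + 1))
    (h' : ¬((w : Equiv.Perm ℕ+) i = k + 1 ∧ (w : Equiv.Perm ℕ+) (i + 1) = k)) :
    IsLeftDescent (w * s i) k ↔ IsLeftDescent w k := by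
  have hi : ∀ a b : ℕ+, (w : Equiv.Perm ℕ+)⁻¹ a = b ↔ (w : Equiv.Perm ℕ+) b = a := fun a b => by
    rw [Equiv.Perm.inv_eq_iff_eq, eq_comm]
  rw [IsLeftDescent, IsLeftDescent, inv_mul_s_apply, inv_mul_s_apply]
  constructor
  · intro hd
    by_contra hn
    refine hd.not_gt (swap_lt_swap (lt_of_le_of_ne (not_lt.1 hn) fun e =>
      (PNat.lt_add_right k 1).ne ((w : Equiv.Perm ℕ+)⁻¹.injective e)) ?_)
    rw [hi, hi]; exact h
  · intro hd
    refine swap_lt_swap hd ?_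
    rw [hi, hi]; tauto

theorem ddLin_nablaTerm {w : SInfty} {i : ℕ+}
    (h : (w : Equiv.Perm ℕ+) i < (w : Equiv.Perm ℕ+) (i + 1)) (k : ℕ+) :
    ddLin i (nablaTerm (w * s i) k) = nablaTerm w k := by
  have hk : k < k + 1 := PNat.lt_add_right k 1
  -- In this exceptional case `s_k w s_i = w`: the term is a multiple of `𝔖_w`, killed by `∂_i`,
  -- while `k` is not a left descent of `w`.
  by_cases hc : (w : Equiv.Perm ℕ+) i = k ∧ (w : Equiv.Perm ℕ+) (i + 1) = k + 1
  · have h1 : s k * (w * s i) = w := by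
      refine Subtype.ext ?_
      change Equiv.swap k (k + 1) * ((w : Equiv.Perm ℕ+) * Equiv.swap i (i + 1)) = w
      rw [Equiv.mul_swap_eq_swap_mul, hc.1, hc.2, ← mul_assoc, Equiv.swap_mul_self, one_mul]
    have h2 : ¬ IsLeftDescent w k := by
      rw [IsLeftDescent, ← hc.2, ← hc.1]
      simpa using (PNat.lt_add_right i 1).le
    rw [nablaTerm, nablaTerm, if_neg h2, h1]
    split_ifs
    · rw [map_smul, ddLin_schubert_of_lt w i h, smul_zero]
    · exact map_zero _
  · have hc' : ¬((w : Equiv.Perm ℕ+) i = k + 1 ∧ (w : Equiv.Perm ℕ+) (i + 1) = k) := by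
      rintro ⟨h1, h2⟩
      rw [h1, h2] at h
      exact h.not_gt hk
    rw [nablaTerm, nablaTerm]
    have hiff := isLeftDescent_mul_s_iff hc hc'
    by_cases hd : IsLeftDescent w k
    · rw [if_pos (hiff.2 hd), if_pos hd, map_smul, ddLin_schubert_of_gt, ← mul_assoc, mul_s_mul_s]
      change Equiv.swap k (k + 1) (((w * s i : SInfty) : Equiv.Perm ℕ+) (i + 1))
        < Equiv.swap k (k + 1) (((w * s i : SInfty) : Equiv.Perm ℕ+) i)
      rw [coe_mul_s, mul_swap_apply_self, mul_swap_apply_right]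
      exact swap_lt_swap h hc
    · rw [if_neg (fun h => hd (hiff.1 h)), if_neg hd, map_zero]

theorem nabla_staircase {m : ℕ} {w : SInfty} (hw : FixesAbove (m + 1) w)
    (h : ∀ i : ℕ+, (i : ℕ) < m + 1 → (w : Equiv.Perm ℕ+) (i + 1) ≤ (w : Equiv.Perm ℕ+) i) :
    nabla (schubert w) = ∑ k ∈ Finset.range m, nablaTerm w k.succPNat := by
  rw [schubert_eq w hw, schubertIn_of_forall _ _ h, staircase_eq_mono, nabla_mono,
    Finset.sum_range_succ]
  simp only [Nat.add_sub_cancel, Nat.sub_self, Nat.cast_zero, zero_smul, add_zero]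
  -- For the long element of `S_{m+1}`, `s_k w = w s_j` when `j + k = m + 1` (one-based), and the
  -- exponent of `x_j` is exactly `k`; this is the origin of the weight `k`.
  rw [← Finset.sum_range_reflect]
  refine Finset.sum_congr rfl fun k hk => ?_
  have hk := Finset.mem_range.1 hk
  obtain ⟨j, rfl⟩ : ∃ j, m = j + k + 1 := ⟨m - 1 - k, by omega⟩
  have ej : j + k + 1 - 1 - k = j := by omega
  rw [ej]
  have ha := hw.apply_add_of_forall h
  have w1 : (w : Equiv.Perm ℕ+) j.succPNat = (k + 1).succPNat := by
    have := ha j (by omega)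
    apply PNat.eq; simp only [Nat.succPNat_coe]; omega
  have w2 : (w : Equiv.Perm ℕ+) (j + 1).succPNat = k.succPNat := by
    have := ha (j + 1) (by omega)
    apply PNat.eq; simp only [Nat.succPNat_coe]; omega
  have hd : IsLeftDescent w k.succPNat := by
    rw [IsLeftDescent, succPNat_add_one, ← w1, ← w2]
    simp
  have hs : s k.succPNat * w = w * s j.succPNat := by
    refine Subtype.ext ?_
    change Equiv.swap k.succPNat (k.succPNat + 1) * (w : Equiv.Perm ℕ+) =
      (w : Equiv.Perm ℕ+) * Equiv.swap j.succPNat (j.succPNat + 1)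
    rw [succPNat_add_one, succPNat_add_one, Equiv.mul_swap_eq_swap_mul, w1, w2, Equiv.swap_comm]
  rw [nablaTerm, if_pos hd, hs, ← ddLin_schubert_of_gt, schubert_eq w hw,
    schubertIn_of_forall _ _ h, staircase_eq_mono, ddLin_mono (by omega) _ (by omega)]
  · congr 1
    simp only [Nat.succPNat_coe]
    congr 1
    omega
  · rw [succPNat_add_one, w1, w2]
    exact Nat.succPNat_lt_succPNat.2 (Nat.lt_succ_self k)

/-- The formula holds for the long element, and `∂_i` carries it from `w s_i` to `w` term by term.
All left descents of an element of `S_{m+1}` are at most `m`. -/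
theorem nabla_schubert {m : ℕ} (w : SInfty) (hw : FixesAbove (m + 1) w) :
    nabla (schubert w) = ∑ k ∈ Finset.range m, nablaTerm w k.succPNat := by
  induction hm : ∑ a ∈ Finset.range (m + 1), (a + 1) * ((w : Equiv.Perm ℕ+) a.succPNat : ℕ)
    using Nat.strong_induction_on generalizing w with
  | _ l ih =>
  by_cases h : ∃ i : ℕ+, (i : ℕ) < m + 1 ∧ (w : Equiv.Perm ℕ+) i < (w : Equiv.Perm ℕ+) (i + 1)
  · obtain ⟨i, hi, h⟩ := h
    have e := congrArg (ddLin i) (ih _ (hm ▸ weight_mul_swap_lt (m + 1) w i hi h) (w * s i)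
      (hw.mul (fixesAbove_swap hi)) rfl)
    rw [← nabla_ddLin, ddLin_schubert_of_gt, mul_s_mul_s, map_sum] at e
    · simpa only [ddLin_nablaTerm h] using e
    · rw [coe_mul_s, mul_swap_apply_self, mul_swap_apply_right]; exact h
  · push Not at h
    exact nabla_staircase hw h

/-! ### Divisibility and extraction of coefficients -/

theorem dvd_nabla_schubert {a : ℤ} {u : SInfty} (hu : ∀ i : ℕ+, IsLeftDescent u i → a ∣ i) :
    ∃ q, nabla (schubert u) = a • q := by
  obtain ⟨n, hn⟩ := exists_bound u
  have h : ∀ k, ∃ q, nablaTerm u k = a • q := fun k => by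
    rw [nablaTerm]
    split_ifs with hd
    · obtain ⟨b, hb⟩ := hu k hd
      exact ⟨b • schubert (s k * u), by rw [hb, mul_smul]⟩
    · exact ⟨0, by simp⟩
  choose q hq using h
  refine ⟨∑ k ∈ Finset.range n, q k.succPNat, ?_⟩
  rw [nabla_schubert u (FixesAbove.mono (Nat.le_succ n) hn), Finset.smul_sum]
  exact Finset.sum_congr rfl fun k _ => hq _

open Classical in
theorem coeffFun_nablaTerm (v w : SInfty) (k : ℕ+) :
    coeffFun w (nablaTerm v k) = if v = s k * w ∧ ¬ IsLeftDescent w k then (k : ℤ) else 0 := by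
  rw [nablaTerm]
  by_cases hv : v = s k * w
  · subst hv
    rw [s_mul_s_mul, isLeftDescent_s_mul]
    by_cases h : IsLeftDescent w k
    · simp [h]
    · rw [if_pos h, if_pos ⟨rfl, h⟩, map_smul, coeffFun_schubert, if_pos rfl, smul_eq_mul, mul_one]
  · rw [if_neg (fun h : v = s k * w ∧ ¬ IsLeftDescent w k => hv h.1)]
    have : s k * v ≠ w := by
      rintro rfl
      exact hv (s_mul_s_mul _ _).symm
    split_ifs
    · rw [map_smul, coeffFun_schubert, if_neg this, smul_zero]
    · exact map_zero _

theorem s_injective : Function.Injective s := by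
  intro i j h
  have h1 : Equiv.swap i (i + 1) = Equiv.swap j (j + 1) := congrArg Subtype.val h
  have h2 := DFunLike.congr_fun h1 i
  rw [Equiv.swap_apply_left, Equiv.swap_apply_def] at h2
  have := PNat.lt_add_right i 1
  split_ifs at h2 with h3 h4
  · exact h3
  · rw [h4, ← PNat.coe_inj] at h2
    simp only [PNat.add_coe, PNat.one_coe] at h2
    omega
  · exact absurd h2 this.ne'

theorem finite_s_mul_ne_zero (c : SInfty →₀ ℤ) (w : SInfty) : {k : ℕ+ | c (s k * w) ≠ 0}.Finite :=
  c.hasFiniteSupport.preimage fun _ _ _ _ h => s_injective (mul_right_cancel h)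

-- The coefficient of `𝔖_w` in `∇ 𝔖_v` is nonzero only for `v = s_k w > w`, when it is `k`;
-- linearity does the rest.
open Classical in
theorem coeffFun_nabla {f : MvPolynomial ℕ+ ℤ} {c : SInfty →₀ ℤ}
    (h : IsSchubertExpansion f c) (w : SInfty) :
    coeffFun w (nabla f) = ∑ᶠ (k : ℕ+) (_ : BruhatLT w (s k * w)), (k : ℤ) * c (s k * w) := by
  choose b hb using exists_bound
  obtain ⟨K, hK⟩ : ∃ K : ℕ, ∀ k : ℕ+, c (s k * w) ≠ 0 → (k : ℕ) ≤ K := by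
    obtain ⟨K, hK⟩ := (finite_s_mul_ne_zero c w).bddAbove
    exact ⟨K, fun k hk => hK hk⟩
  -- Large enough both to place the whole support in `S_{m+1}` and to bound every contributing `k`.
  set m : ℕ := max K (c.support.sup b) with hm
  have h1 : ∀ v ∈ c.support, FixesAbove (m + 1) (v : Equiv.Perm ℕ+) := fun v hv =>
    FixesAbove.mono (((Finset.le_sup hv).trans (le_max_right _ _)).trans (Nat.le_succ _)) (hb v)
  have e1 : coeffFun w (nabla f) = ∑ v ∈ c.support, ∑ k ∈ Finset.range m,
      c v * (if v = s k.succPNat * w ∧ ¬ IsLeftDescent w k.succPNat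
        then (k.succPNat : ℤ) else 0) := by
    rw [h, Finsupp.sum, map_sum, map_sum]
    refine Finset.sum_congr rfl fun v hv => ?_
    rw [Derivation.map_smul, map_smul, nabla_schubert v (h1 v hv), map_sum, smul_eq_mul,
      Finset.mul_sum]
    exact Finset.sum_congr rfl fun k _ => by rw [coeffFun_nablaTerm]
  have e2 : ∀ k : ℕ+, (∑ v ∈ c.support, c v * (if v = s k * w ∧ ¬ IsLeftDescent w k
        then (k : ℤ) else 0)) = if ¬ IsLeftDescent w k then (k : ℤ) * c (s k * w) else 0 := by
    intro k
    by_cases hd : IsLeftDescent w k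
    · simp [hd]
    · simp only [hd, not_false_eq_true, and_true, mul_ite, mul_zero, if_true]
      rw [Finset.sum_ite_eq']
      split_ifs with hs
      · exact mul_comm _ _
      · rw [Finsupp.notMem_support_iff.1 hs, mul_zero]
  rw [e1, Finset.sum_comm, Finset.sum_congr rfl fun k _ => e2 k.succPNat]
  simp only [bruhatLT_s_mul_iff, finsum_eq_if]
  rw [finsum_eq_sum_of_support_subset (s := (Finset.range m).map
    ⟨Nat.succPNat, Nat.succPNat_injective⟩), Finset.sum_map]
  · rfl
  · intro k hk
    rw [Function.mem_support] at hk
    have hk' : c (s k * w) ≠ 0 := fun h0 => hk (by simp [h0])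
    have := (hK k hk').trans (le_max_left K (c.support.sup b))
    have hp := k.pos
    simp only [Finset.coe_map, Function.Embedding.coeFn_mk, Set.mem_image, Finset.mem_coe,
      Finset.mem_range]
    exact ⟨k.natPred, by rw [PNat.natPred]; omega, PNat.succPNat_natPred k⟩

end Schubert

end

/-! ### The congruences -/

open Schubert in
theorem mainTheorem3 (u v : SInfty) (α : ℕ+)
    (hu : ∀ i : ℕ+, IsLeftDescent u i → α ∣ i)
    (hv : ∀ i : ℕ+, IsLeftDescent v i → α ∣ i) :
    -- the structure coefficients of `u`, `v` are well defined
    (∃! c : SInfty →₀ ℤ, IsSchubertExpansion (schubert u * schubert v) c) ∧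
    IsSchubertExpansion (schubert u * schubert v) (structureCoeff u v) ∧
    ∀ w : SInfty,
      -- the sum over `k` is finite
      {k : ℕ+ | BruhatLT w (s k * w) ∧ structureCoeff u v (s k * w) ≠ 0}.Finite ∧
      (∑ᶠ (k : ℕ+) (_ : BruhatLT w (s k * w)), (k : ℤ) * structureCoeff u v (s k * w))
        ≡ 0 [ZMOD (α : ℤ)] ∧
      (u = v →
        (∑ᶠ (k : ℕ+) (_ : BruhatLT w (s k * w)), (k : ℤ) * structureCoeff u v (s k * w))
          ≡ 0 [ZMOD 2 * (α : ℤ)]) := by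
  have hc := isSchubertExpansion_structureCoeff u v
  have cast : ∀ i : ℕ+, α ∣ i → ((α : ℕ) : ℤ) ∣ ((i : ℕ) : ℤ) := fun i h =>
    Int.natCast_dvd_natCast.2 (PNat.dvd_iff.1 h)
  obtain ⟨p, hp⟩ := dvd_nabla_schubert (a := α) fun i hi => cast i (hu i hi)
  obtain ⟨q, hq⟩ := dvd_nabla_schubert (a := α) fun i hi => cast i (hv i hi)
  refine ⟨existsUnique_expansion _, hc, fun w => ⟨?_, ?_, ?_⟩⟩
  · exact (finite_s_mul_ne_zero (structureCoeff u v) w).subset fun k hk => hk.2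
  · rw [← coeffFun_nabla hc, Int.modEq_zero_iff_dvd, Derivation.leibniz, hp, hq, smul_comm,
      smul_comm (schubert v), ← smul_add, map_smul]
    exact Dvd.intro _ rfl
  · rintro rfl
    -- For `u = v` the two Leibniz summands coincide, giving twice a multiple of `α`.
    rw [← coeffFun_nabla hc, Int.modEq_zero_iff_dvd, Derivation.leibniz, hp, smul_comm,
      ← smul_add, ← two_smul ℤ, map_smul, map_smul, smul_eq_mul, smul_eq_mul]
    exact ⟨coeffFun w (schubert u • p), by ring⟩
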